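/- For subspaces $U,V$ of $\mathbb{F}_2^n$ let $d_S(U,V)=\dim(U+V)-\dim(U\cap V)$, and let $A_2(n,d;k)$ be the maximum cardinality of a set of $k$-dimensional subspaces of $\mathbb{F}_2^n$ any two distinct members of which satisfy $d_S(U,V)\ge d$. A partial $k$-spread in $\mathbb{F}_2^n$ is a set of $k$-dimensional subspaces such that every one-dimensional subspace is contained in at most one of them. A set of $k\times w$ matrices over $\mathbb{F}_2$ is an MRD code with minimum rank distance at least $k$ if $\operatorname{rk}(A-B)\ge k$ for any two distinct members $A,B$ and its cardinality is $2^w$ if $w\ge k$, and $1$ if $w<k$. A multi-component code in $\mathbb{F}_2^n$ is a union $\bigcup_{i=1}^{\lfloor n/k\rfloor}\{\operatorname{rowspace}(0\mid I_k\mid M) : M\in\mathcal{R}_i\}$, where $0$ is the $k\times(i-1)k$ zero matrix, $I_k$ is the $k\times k$ identity matrix, and $\mathcal{R}_i$ is an MRD code of $k\times(n-ik)$ matrices with minimum rank distance at least $k$. **Theorem.** Let $t\ge 1$ and $k\ge 4$ be integers and let $n=k(t+1)+2$. Then $$A_2(n,2k;k)=\frac{2^{k(t+1)+2}-3\cdot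 2^k-1}{2^k-1},$$ and this is the maximum size of a partial $k$-spread in $\mathbb{F}_2^n$. Moreover, multi-component codes in $\mathbb{F}_2^n$ exist, and every one of them is a partial $k$-spread of this maximum size. -/

import Mathlib

namespace SubspaceCode

/-- The subspace distance `d_S(U, V) = dim (U + V) - dim (U ∩ V)` on the subspaces of `F ^ n`.
The subtraction does not truncate, since `U ⊓ V ≤ U ⊔ V`. -/
noncomputable def subspaceDist {F : Type} [Field F] {n : ℕ}
    (U V : Submodule F (Fin n → F)) : ℕ :=
  Module.finrank F (U ⊔ V : Submodule F (Fin n → F)) -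
    Module.finrank F (U ⊓ V : Submodule F (Fin n → F))

/-- `C` is a subspace code in `F ^ n` with minimum subspace distance at least `d`, all of whose
codewords have their dimension in `D`. -/
def IsCode {F : Type} [Field F] {n : ℕ} (d : ℕ) (D : Set ℕ)
    (C : Finset (Submodule F (Fin n → F))) : Prop :=
  (∀ U ∈ C, Module.finrank F U ∈ D) ∧
    ∀ U ∈ C, ∀ V ∈ C, U ≠ V → d ≤ subspaceDist U V

/-- `A_q(n, d; D)`, with `F` the field of `q` elements: the maximum cardinality of a subspace code
in `F ^ n` with minimum subspace distance at least `d` and all dimensions in `D`. -/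
noncomputable def maxCodeSize (F : Type) [Field F] [Finite F] (n d : ℕ) (D : Set ℕ) : ℕ :=
  sSup {m : ℕ | ∃ C : Finset (Submodule F (Fin n → F)), IsCode d D C ∧ C.card = m}

/-- The supremum that defines `A_q(n, d; D)` is a maximum. -/
theorem isGreatest_maxCodeSize (F : Type) [Field F] [Finite F] (n d : ℕ) (D : Set ℕ) :
    IsGreatest {m : ℕ | ∃ C : Finset (Submodule F (Fin n → F)), IsCode d D C ∧ C.card = m}
      (maxCodeSize F n d D) := by
  have hb : BddAbove
      {m : ℕ | ∃ C : Finset (Submodule F (Fin n → F)), IsCode d D C ∧ C.card = m} := by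
    have : Finite (Submodule F (Fin n → F)) :=
      Finite.of_injective (fun U => (U : Set (Fin n → F))) SetLike.coe_injective
    have := Fintype.ofFinite (Submodule F (Fin n → F))
    refine ⟨Fintype.card (Submodule F (Fin n → F)), ?_⟩
    rintro m ⟨C, -, rfl⟩
    exact Finset.card_le_univ C
  refine ⟨Nat.sSup_mem ⟨0, ∅, ⟨by simp, by simp⟩, rfl⟩ hb, fun m hm => le_csSup hb hm⟩

/-- A partial `k`-spread in `F ^ n`: a collection of `k`-dimensional subspaces such that every
point (one-dimensional subspace) is contained in at most one of them. -/
def IsPartialSpread {F : Type} [Field F] {n : ℕ} (k : ℕ)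
    (P : Finset (Submodule F (Fin n → F))) : Prop :=
  (∀ U ∈ P, Module.finrank F U = k) ∧
    ∀ p : Submodule F (Fin n → F), Module.finrank F p = 1 →
      ∀ U ∈ P, ∀ V ∈ P, p ≤ U → p ≤ V → U = V

/-- A maximum rank distance code with minimum rank distance at least `d ≥ 1`: its size is
`q ^ (max (m, n) * (min (m, n) - d + 1))` if `d ≤ min (m, n)`, and `1` otherwise (the truncated
subtraction below makes the exponent `0` in that case). -/
def IsMRD {F : Type} [Field F] {m n : ℕ} (d : ℕ) (C : Finset (Matrix (Fin m) (Fin n) F)) : Prop :=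
  (∀ A ∈ C, ∀ B ∈ C, A ≠ B → d ≤ (A - B).rank) ∧
    C.card = Nat.card F ^ (max m n * (min m n + 1 - d))

/-- The `k × n` block matrix `(0 | I | M)` with `a` zero columns, followed by the `k × k` identity
matrix, followed by the `k × (n - (a + k))` matrix `M`. It is the matrix in reduced row echelon form
with pivot columns `a, …, a + k - 1` (counted from `0`) and free part `M`. -/
def liftMatrix {F : Type} [Field F] {k n : ℕ} (a : ℕ) (M : Matrix (Fin k) (Fin (n - (a + k))) F) :
    Matrix (Fin k) (Fin n) F :=
  Matrix.of fun r c =>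
    if h : a + k ≤ (c : ℕ) then M r ⟨(c : ℕ) - (a + k), by omega⟩
    else if (c : ℕ) = a + (r : ℕ) then 1 else 0

/-- The lifted subspace: the row space of `(0 | I | M)`. -/
def lift {F : Type} [Field F] {k n : ℕ} (a : ℕ) (M : Matrix (Fin k) (Fin (n - (a + k))) F) :
    Submodule F (Fin n → F) :=
  Submodule.span F (Set.range (liftMatrix a M).row)

/-- `C` arises from the multi-component construction: it is the union, over the `⌊n / k⌋` blocks of
pivot columns `i * k, …, i * k + k - 1` with `0 ≤ i < ⌊n / k⌋`, of lifted MRD codes with minimum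
rank distance at least `k`. -/
def IsMultiComponent {F : Type} [Field F] {n : ℕ} (k : ℕ)
    (C : Finset (Submodule F (Fin n → F))) : Prop :=
  ∃ R : (i : Fin (n / k)) → Finset (Matrix (Fin k) (Fin (n - ((i : ℕ) * k + k))) F),
    (∀ i, IsMRD k (R i)) ∧
      (C : Set (Submodule F (Fin n → F))) =
        ⋃ i : Fin (n / k),
          (fun M => lift ((i : ℕ) * k) M) ''
            (R i : Set (Matrix (Fin k) (Fin (n - ((i : ℕ) * k + k))) F))

end SubspaceCode

/-! Distance `2 * k` between `k`-spaces means trivial intersection, so codes are partial spreads.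
The holes of a partial spread, meaning the uncovered nonzero vectors, form a `2 ^ (k - 1)`-divisible
set, because a hyperplane meets every `k`-space in a multiple of `2 ^ (k - 1)` vectors.

A multi-component code leaves `3 * 2 ^ k` holes. One more member would leave `3 * 2 ^ k - (2 ^ k -
1) = 4 * Δ + 1` holes with `Δ = 2 ^ (k - 1)`. This is impossible: some hyperplane contains fewer
than half of the holes, and restricting to it halves the divisibility. Since counts are `1` modulo
`Δ`, the restriction has `1` or `Δ + 1` elements; a second such restriction reduces the latter case
to a single vector, and no nonzero vector is divisible on its own by a modulus above 1
(`card_ne_four_mul_add_one`).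

For the lower bound, pivot positions and rank distance make lifted MRD codes disjoint
(`eq_zero_of_mem_lift_of_sigma_ne`), a geometric sum gives their number, and multiplication in an
extension field provides MRD codes. -/

namespace SubspaceCode

open Finset Module

/-! ### Divisible sets of binary vectors and their excluded cardinalities. -/

section Divisible

variable {n : ℕ}

/-- A set `N` of vectors is `Δ`-divisible if the number of its elements in every hyperplane is
congruent to its cardinality modulo `Δ`. -/
def IsDivisible (Δ : ℕ) (N : Finset (Fin n → ZMod 2)) : Prop :=
  ∀ a : Fin n → ZMod 2, #{x ∈ N | a ⬝ᵥ x = 0} ≡ #N [MOD Δ]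

/-- Adding a unit vector at a coordinate where `x` is `1` flips the value of `a ⬝ᵥ x`. -/
theorem two_mul_card_dotProduct_eq_zero {x : Fin n → ZMod 2} (hx : x ≠ 0) :
    2 * #{a : Fin n → ZMod 2 | a ⬝ᵥ x = 0} = 2 ^ n := by
  obtain ⟨i, hi⟩ := Function.ne_iff.1 hx
  have hi1 : x i = 1 := (Fin.eq_one_of_ne_zero (x i) hi)
  have h : #{a : Fin n → ZMod 2 | a ⬝ᵥ x = 0} = #{a : Fin n → ZMod 2 | ¬ a ⬝ᵥ x = 0} := by
    refine card_bij' (fun a _ => a + Pi.single i 1) (fun a _ => a + Pi.single i 1) ?_ ?_ ?_ ?_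
    · intro a ha
      simp_all [add_dotProduct]
    · intro a ha
      simp only [mem_filter, mem_univ, true_and] at ha
      have h1 : a ⬝ᵥ x = 1 := Fin.eq_one_of_ne_zero _ ha
      rw [mem_filter, add_dotProduct, h1, single_dotProduct, hi1]
      exact ⟨mem_univ _, rfl⟩
    all_goals
      intro a _
      rw [add_assoc, ← Pi.single_add, show (1 : ZMod 2) + 1 = 0 from rfl, Pi.single_zero, add_zero]
  have h2 := card_filter_add_card_filter_not (s := (univ : Finset (Fin n → ZMod 2)))
    (fun a => a ⬝ᵥ x = 0)
  rw [← h] at h2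
  rw [two_mul, h2]
  simp [ZMod.card]

/-- Some hyperplane contains less than half of the elements of a nonempty set of nonzero vectors. -/
theorem exists_two_mul_card_filter_lt {N : Finset (Fin n → ZMod 2)} (h0 : ∀ x ∈ N, x ≠ 0)
    (hN : N.Nonempty) : ∃ a : Fin n → ZMod 2, 2 * #{x ∈ N | a ⬝ᵥ x = 0} < #N := by
  by_contra! hc
  have h1 : ∑ a : Fin n → ZMod 2, 2 * #{x ∈ N | a ⬝ᵥ x = 0} = ∑ _a : Fin n → ZMod 2, #N := by
    rw [← mul_sum]
    have := sum_card_bipartiteAbove_eq_sum_card_bipartiteBelow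
      (s := (univ : Finset (Fin n → ZMod 2))) (t := N) (fun a x => a ⬝ᵥ x = 0)
    simp only [bipartiteAbove, bipartiteBelow] at this
    rw [this, mul_sum, sum_congr rfl fun x hx => two_mul_card_dotProduct_eq_zero (h0 x hx)]
    simp [ZMod.card, mul_comm]
  have h2 : ∑ _a : Fin n → ZMod 2, #N < ∑ a : Fin n → ZMod 2, 2 * #{x ∈ N | a ⬝ᵥ x = 0} := by
    -- The average over all `a` is exactly half; `a = 0`, whose "hyperplane" is the whole space,
    -- lies strictly above it.
    refine sum_lt_sum (fun a _ => hc a) ⟨0, mem_univ _, ?_⟩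
    have := hN.card_pos
    simp only [zero_dotProduct, filter_true]
    omega
  omega

/-- Among `u`, `v`, `u + v` in `ZMod 2`, either all three vanish or exactly one does. -/
theorem card_filter_add_card_filter_add_card_filter (N : Finset (Fin n → ZMod 2))
    (a b : Fin n → ZMod 2) :
    #{x ∈ N | a ⬝ᵥ x = 0} + #{x ∈ N | b ⬝ᵥ x = 0} + #{x ∈ N | (a + b) ⬝ᵥ x = 0} =
      2 * #{x ∈ N | a ⬝ᵥ x = 0 ∧ b ⬝ᵥ x = 0} + #N := by
  rw [card_eq_sum_ones N]
  simp only [card_filter, mul_sum, ← sum_add_distrib, add_dotProduct]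
  refine sum_congr rfl fun x _ => ?_
  generalize a ⬝ᵥ x = u
  generalize b ⬝ᵥ x = v
  revert u v
  decide

/-- The intersection of a `2 * Δ`-divisible set with a hyperplane is `Δ`-divisible. -/
theorem IsDivisible.filter {Δ : ℕ} {N : Finset (Fin n → ZMod 2)} (h : IsDivisible (2 * Δ) N)
    (a : Fin n → ZMod 2) : IsDivisible Δ {x ∈ N | a ⬝ᵥ x = 0} := by
  intro b
  -- All three counts in the identity are `#N` modulo `2 * Δ`; cancelling the factor 2 costs half of
  -- the modulus.
  have h1 : 2 * #{x ∈ N | a ⬝ᵥ x = 0 ∧ b ⬝ᵥ x = 0} ≡ 2 * #N [MOD 2 * Δ] := by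
    refine Nat.ModEq.add_right_cancel' #N ?_
    rw [← card_filter_add_card_filter_add_card_filter]
    rw [two_mul #N]
    exact ((h a).add (h b)).add (h (a + b))
  have h2 := Nat.ModEq.mul_left_cancel' two_ne_zero h1
  rw [filter_filter]
  exact h2.trans ((h a).of_mul_left 2).symm

/-- Some hyperplane misses the single vector, so `0` and `1` would be congruent. -/
theorem IsDivisible.card_ne_one {Δ : ℕ} {N : Finset (Fin n → ZMod 2)} (h : IsDivisible Δ N)
    (h0 : ∀ x ∈ N, x ≠ 0) (hΔ : 1 < Δ) : #N ≠ 1 := by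
  intro h1
  obtain ⟨a, ha⟩ := exists_two_mul_card_filter_lt h0 (card_pos.1 (by omega))
  have h2 := h a
  rw [show #{x ∈ N | a ⬝ᵥ x = 0} = 0 by omega, h1, Nat.ModEq, Nat.mod_eq_of_lt hΔ] at h2
  simp at h2

/-- A hyperplane with fewer than half of the elements has at most `2 * Δ` of them, and `1` modulo `2
* Δ`, hence exactly one. -/
theorem IsDivisible.card_ne_two_mul_add_one {Δ : ℕ} {N : Finset (Fin n → ZMod 2)}
    (h : IsDivisible (2 * Δ) N) (h0 : ∀ x ∈ N, x ≠ 0) (hΔ : 1 < Δ) :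
    #N ≠ 2 * (2 * Δ) + 1 := by
  intro h1
  obtain ⟨a, ha⟩ := exists_two_mul_card_filter_lt h0 (card_pos.1 (by omega))
  refine (h.filter a).card_ne_one (fun x hx => h0 x (mem_filter.1 hx).1) hΔ ?_
  have h2 := h a
  rw [h1, Nat.ModEq, Nat.mul_add_mod_self_right, Nat.mod_eq_of_lt (by omega : 1 < 2 * Δ)] at h2
  by_contra hne
  have h3 := Nat.mod_add_div #{x ∈ N | a ⬝ᵥ x = 0} (2 * Δ)
  rw [h2] at h3
  rcases Nat.eq_zero_or_pos (#{x ∈ N | a ⬝ᵥ x = 0} / (2 * Δ)) with hz | hp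
  · rw [hz] at h3; omega
  · have := Nat.le_mul_of_pos_right (2 * Δ) hp
    omega

theorem IsDivisible.card_ne_four_mul_add_one {Δ : ℕ} {N : Finset (Fin n → ZMod 2)}
    (h : IsDivisible (2 * (2 * Δ)) N) (h0 : ∀ x ∈ N, x ≠ 0) (hΔ : 1 < Δ) :
    #N ≠ 4 * (2 * (2 * Δ)) + 1 := by
  intro h1
  obtain ⟨a, ha⟩ := exists_two_mul_card_filter_lt h0 (card_pos.1 (by omega))
  have h0' : ∀ x ∈ ({x ∈ N | a ⬝ᵥ x = 0} : Finset _), x ≠ 0 := fun x hx => h0 x (mem_filter.1 hx).1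
  have hone := (h.filter a).card_ne_one h0' (by omega)
  have htwo := (h.filter a).card_ne_two_mul_add_one h0' hΔ
  have h2 := h a
  rw [h1, Nat.ModEq, Nat.mul_add_mod_self_right,
    Nat.mod_eq_of_lt (by omega : 1 < 2 * (2 * Δ))] at h2
  have h3 := Nat.mod_add_div #{x ∈ N | a ⬝ᵥ x = 0} (2 * (2 * Δ))
  rw [h2] at h3
  -- The quotient is `0` (one element), `1` (excluded by `htwo`), or at least `2`, which exceeds
  -- half of `N`.
  rcases Nat.lt_trichotomy (#{x ∈ N | a ⬝ᵥ x = 0} / (2 * (2 * Δ))) 1 with hz | hz | hz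
  · rw [Nat.lt_one_iff.1 hz] at h3; omega
  · rw [hz] at h3; omega
  · have := Nat.mul_le_mul_left (2 * (2 * Δ)) hz
    omega

end Divisible

/-! ### Holes of a partial spread and the upper bound. -/

section Holes

variable {n k : ℕ}

open Classical in
/-- The holes of a collection of subspaces: the nonzero vectors that none of them contains. -/
noncomputable def holes (P : Finset (Submodule (ZMod 2) (Fin n → ZMod 2))) :
    Finset (Fin n → ZMod 2) :=
  {x | x ≠ 0 ∧ ∀ U ∈ P, x ∉ U}

theorem IsPartialSpread.eq_of_mem {F : Type} [Field F]
    {P : Finset (Submodule F (Fin n → F))} (hP : IsPartialSpread k P)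
    {U V : Submodule F (Fin n → F)} (hU : U ∈ P) (hV : V ∈ P)
    {x : Fin n → F} (hx : x ≠ 0) (hxU : x ∈ U) (hxV : x ∈ V) : U = V :=
  hP.2 (Submodule.span F {x}) (finrank_span_singleton hx) U hU V hV
    (by simpa [Submodule.span_singleton_le_iff_mem]) (by simpa [Submodule.span_singleton_le_iff_mem])

open Classical in
theorem IsPartialSpread.card_holes_filter_add {P : Finset (Submodule (ZMod 2) (Fin n → ZMod 2))}
    (hP : IsPartialSpread k P) (a : Fin n → ZMod 2) :
    #{x ∈ holes P | a ⬝ᵥ x = 0} +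
        ∑ U ∈ P, #{x : Fin n → ZMod 2 | x ≠ 0 ∧ x ∈ U ∧ a ⬝ᵥ x = 0} =
      #{x : Fin n → ZMod 2 | x ≠ 0 ∧ a ⬝ᵥ x = 0} := by
  rw [← card_biUnion, ← card_union_of_disjoint]
  · congr 1
    ext x
    simp only [holes, mem_union, mem_filter, mem_univ, true_and, mem_biUnion]
    by_cases h : ∃ U ∈ P, x ∈ U <;> grind
  · rw [disjoint_left]
    intro x hx
    simp only [holes, mem_filter, mem_univ, true_and, mem_biUnion] at hx ⊢
    rintro ⟨U, hU, -, hxU, -⟩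
    exact hx.1.2 U hU hxU
  · intro U hU V hV hne
    refine disjoint_left.2 ?_
    intro x hx hx'
    simp only [mem_filter, mem_univ, true_and] at hx hx'
    exact hne (hP.eq_of_mem hU hV hx.1 hx.2.1 hx'.2.1)

theorem card_filter_ne_zero_add_one (p : (Fin n → ZMod 2) → Prop) [DecidablePred p] (h0 : p 0) :
    #{x : Fin n → ZMod 2 | x ≠ 0 ∧ p x} + 1 = #{x : Fin n → ZMod 2 | p x} := by
  rw [← card_insert_of_notMem (a := (0 : Fin n → ZMod 2)) (by simp)]
  congr 1
  ext x
  by_cases hx : x = 0 <;> simp [hx, h0]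

open Classical in
theorem card_filter_mem_submodule (U : Submodule (ZMod 2) (Fin n → ZMod 2)) :
    #{x : Fin n → ZMod 2 | x ∈ U} = 2 ^ finrank (ZMod 2) U := by
  rw [← Fintype.card_subtype, Module.card_eq_pow_finrank (K := ZMod 2) (V := U), ZMod.card]

open Classical in
/-- A hyperplane meets a `k`-dimensional subspace in at least `k - 1` dimensions. -/
theorem two_pow_dvd_card_filter_mem {U : Submodule (ZMod 2) (Fin n → ZMod 2)} {k : ℕ}
    (hU : k + 1 ≤ finrank (ZMod 2) U) (a : Fin n → ZMod 2) :
    2 ^ k ∣ #{x : Fin n → ZMod 2 | x ∈ U ∧ a ⬝ᵥ x = 0} := by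
  let f : (Fin n → ZMod 2) →ₗ[ZMod 2] ZMod 2 := dotProductBilin (ZMod 2) (ZMod 2) a
  have h1 : #{x : Fin n → ZMod 2 | x ∈ U ∧ a ⬝ᵥ x = 0} =
      #{x : Fin n → ZMod 2 | x ∈ U ⊓ LinearMap.ker f} := by
    congr 1
    ext x
    simp [f]
  rw [h1, card_filter_mem_submodule]
  refine pow_dvd_pow 2 ?_
  have h2 := Submodule.finrank_sup_add_finrank_inf_eq U (LinearMap.ker f)
  have h3 := Submodule.finrank_le (U ⊔ LinearMap.ker f)
  have h4 := LinearMap.finrank_range_add_finrank_ker f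
  have h5 := Submodule.finrank_le (LinearMap.range f)
  rw [finrank_self] at h5
  omega

/-- Each member has `-1` modulo `2 ^ k` nonzero vectors in a hyperplane, and so does the whole
space; the congruence `key` therefore does not depend on `a`. -/
theorem IsPartialSpread.isDivisible_holes {P : Finset (Submodule (ZMod 2) (Fin n → ZMod 2))}
    (hP : IsPartialSpread (k + 1) P) (hk : k + 1 ≤ n) : IsDivisible (2 ^ k) (holes P) := by
  classical
  have key (a : Fin n → ZMod 2) : #{x ∈ holes P | a ⬝ᵥ x = 0} + 1 ≡ #P [MOD 2 ^ k] := by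
    have h1 := hP.card_holes_filter_add a
    have h2 : ∑ U ∈ P, #{x : Fin n → ZMod 2 | x ≠ 0 ∧ x ∈ U ∧ a ⬝ᵥ x = 0} + #P ≡ 0
        [MOD 2 ^ k] := by
      rw [card_eq_sum_ones, ← sum_add_distrib, Nat.modEq_zero_iff_dvd]
      refine dvd_sum fun U hU => ?_
      rw [card_filter_ne_zero_add_one (fun x => x ∈ U ∧ a ⬝ᵥ x = 0) (by simp)]
      exact two_pow_dvd_card_filter_mem (hP.1 U hU).ge a
    have h3 : #{x : Fin n → ZMod 2 | x ≠ 0 ∧ a ⬝ᵥ x = 0} + 1 ≡ 0 [MOD 2 ^ k] := by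
      rw [card_filter_ne_zero_add_one (fun x => a ⬝ᵥ x = 0) (by simp), Nat.modEq_zero_iff_dvd]
      simpa using two_pow_dvd_card_filter_mem (U := ⊤) (k := k) (by simpa using hk) a
    rw [← h1] at h3
    refine Nat.ModEq.add_right_cancel'
      (∑ U ∈ P, #{x : Fin n → ZMod 2 | x ≠ 0 ∧ x ∈ U ∧ a ⬝ᵥ x = 0}) ?_
    rw [add_right_comm, add_comm #P]
    exact h3.trans h2.symm
  intro a
  have h0 := key 0
  simp only [zero_dotProduct, filter_true] at h0
  exact Nat.ModEq.add_right_cancel' 1 ((key a).trans h0.symm)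

theorem IsPartialSpread.card_holes_add {P : Finset (Submodule (ZMod 2) (Fin n → ZMod 2))}
    (hP : IsPartialSpread k P) : #(holes P) + #P * (2 ^ k - 1) + 1 = 2 ^ n := by
  classical
  have h1 := hP.card_holes_filter_add 0
  simp only [zero_dotProduct, filter_true, and_true] at h1
  have h2 : ∀ U ∈ P, #{x : Fin n → ZMod 2 | x ≠ 0 ∧ x ∈ U} = 2 ^ k - 1 := by
    intro U hU
    rw [← hP.1 U hU, ← card_filter_mem_submodule U,
      ← card_filter_ne_zero_add_one (fun x => x ∈ U) (by simp), Nat.add_sub_cancel]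
  have h3 := card_filter_ne_zero_add_one (n := n) (fun _ => True) trivial
  simp only [and_true, filter_true, card_univ, Fintype.card_fun, ZMod.card, Fintype.card_fin] at h3
  rw [sum_congr rfl h2, sum_const, smul_eq_mul] at h1
  rw [h1, h3]

/-- A partial `k`-spread of `𝔽₂ⁿ` with `k ≥ 4` cannot leave exactly `2 ^ (k + 1) + 1` holes. -/
theorem IsPartialSpread.card_mul_ne {P : Finset (Submodule (ZMod 2) (Fin n → ZMod 2))}
    (hP : IsPartialSpread k P) (hk : 4 ≤ k) (hkn : k ≤ n) :
    #P * (2 ^ k - 1) + 2 ^ (k + 1) + 2 ≠ 2 ^ n := by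
  intro h
  obtain ⟨j, rfl⟩ : ∃ j, k = j + 4 := ⟨k - 4, by omega⟩
  have h1 := hP.card_holes_add
  have hd := IsPartialSpread.isDivisible_holes (k := j + 3) hP hkn
  -- Two halvings must leave a modulus above 1; `4 ≤ k` ensures this.
  rw [show 2 ^ (j + 3) = 2 * (2 * 2 ^ (j + 1)) by ring] at hd
  refine hd.card_ne_four_mul_add_one (fun x hx => ?_)
    (Nat.one_lt_pow (by omega) one_lt_two) ?_
  · simp only [holes, mem_filter] at hx
    exact hx.2.1
  · have : 2 ^ (j + 4 + 1) = 4 * (2 * (2 * 2 ^ (j + 1))) := by ring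
    omega

theorem IsPartialSpread.mono {F : Type} [Field F] {P Q : Finset (Submodule F (Fin n → F))}
    (hP : IsPartialSpread k P) (hQ : Q ⊆ P) : IsPartialSpread k Q :=
  ⟨fun U hU => hP.1 U (hQ hU), fun p hp U hU V hV => hP.2 p hp U (hQ hU) V (hQ hV)⟩

/-- A larger spread would contain one of size `m + 1`, with exactly the forbidden number of holes.
-/
theorem IsPartialSpread.card_le {P : Finset (Submodule (ZMod 2) (Fin n → ZMod 2))}
    (hP : IsPartialSpread k P) (hk : 4 ≤ k) (hkn : k ≤ n) {m : ℕ}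
    (hm : m * (2 ^ k - 1) + 3 * 2 ^ k + 1 = 2 ^ n) : #P ≤ m := by
  by_contra! hlt
  obtain ⟨Q, hQ, hcard⟩ := exists_subset_card_eq (Nat.succ_le_of_lt hlt)
  refine (hP.mono hQ).card_mul_ne hk hkn ?_
  have := Nat.one_le_two_pow (n := k)
  rw [hcard, Nat.succ_mul, pow_succ]
  omega

end Holes

/-- Codes in the Grassmannian with the maximal minimum distance are the partial spreads. -/
theorem isCode_iff_isPartialSpread {F : Type} [Field F] {n k : ℕ}
    (C : Finset (Submodule F (Fin n → F))) :
    IsCode (2 * k) {k} C ↔ IsPartialSpread k C := by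
  refine and_congr_right fun h1 => ?_
  have hd {U V : Submodule F (Fin n → F)} (hU : U ∈ C) (hV : V ∈ C) :
      2 * k ≤ subspaceDist U V ↔ U ⊓ V = ⊥ := by
    have h2 := Submodule.finrank_sup_add_finrank_inf_eq U V
    have hU' : finrank F U = k := h1 U hU
    have hV' : finrank F V = k := h1 V hV
    rw [← Submodule.finrank_eq_zero (R := F), subspaceDist]
    have := Submodule.finrank_mono (R := F) (inf_le_sup : U ⊓ V ≤ U ⊔ V)
    omega
  constructor
  · intro h p hp U hU V hV hpU hpV
    by_contra hne
    have h3 := (hd hU hV).1 (h U hU V hV hne)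
    have h4 : p = ⊥ := le_bot_iff.1 (h3 ▸ le_inf hpU hpV)
    subst h4
    exact zero_ne_one ((finrank_bot F _).symm.trans hp)
  · intro h U hU V hV hne
    rw [hd hU hV, Submodule.eq_bot_iff]
    rintro x ⟨hxU, hxV⟩
    by_contra hx
    exact hne (IsPartialSpread.eq_of_mem ⟨h1, h⟩ hU hV hx hxU hxV)

/-! ### Multi-component codes: disjointness, existence, size. -/

section MultiComponent

variable {F : Type} [Field F] {k n : ℕ}

theorem mem_lift {a : ℕ} {M : Matrix (Fin k) (Fin (n - (a + k))) F} {x : Fin n → F} :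
    x ∈ lift a M ↔ ∃ c : Fin k → F, Matrix.vecMul c (liftMatrix a M) = x := by
  rw [lift, ← range_vecMulLinear]
  rfl

theorem vecMul_liftMatrix_pivot {a : ℕ} (M : Matrix (Fin k) (Fin (n - (a + k))) F) (c : Fin k → F)
    (r : Fin k) (h : a + r < n) : Matrix.vecMul c (liftMatrix a M) ⟨a + r, h⟩ = c r := by
  rw [Matrix.vecMul, dotProduct, sum_eq_single r]
  · simp [liftMatrix]
  · intro s _ hs
    have : ¬ (r : ℕ) = s := fun h => hs (Fin.ext h.symm)
    simp [liftMatrix, this]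
  · simp

theorem vecMul_liftMatrix_free {a : ℕ} (M : Matrix (Fin k) (Fin (n - (a + k))) F) (c : Fin k → F)
    (j : Fin (n - (a + k))) :
    Matrix.vecMul c (liftMatrix a M) ⟨a + k + j, by omega⟩ = Matrix.vecMul c M j := by
  simp [Matrix.vecMul, dotProduct, liftMatrix]

theorem vecMul_liftMatrix_of_lt {a : ℕ} (M : Matrix (Fin k) (Fin (n - (a + k))) F) (c : Fin k → F)
    (j : Fin n) (hj : (j : ℕ) < a) : Matrix.vecMul c (liftMatrix a M) j = 0 := by
  rw [Matrix.vecMul, dotProduct]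
  refine sum_eq_zero fun r _ => ?_
  have h1 : ¬ a + k ≤ (j : ℕ) := by omega
  have h2 : ¬ (j : ℕ) = a + r := by omega
  simp [liftMatrix, h1, h2]

theorem finrank_lift {a : ℕ} (M : Matrix (Fin k) (Fin (n - (a + k))) F) (h : a + k ≤ n) :
    finrank F (lift a M) = k := by
  have hli : LinearIndependent F (liftMatrix a M).row := by
    rw [← Matrix.vecMul_injective_iff]
    intro c d hcd
    funext r
    have := congrFun hcd ⟨a + r, by omega⟩
    simpa only [vecMul_liftMatrix_pivot] using this
  rw [lift, finrank_span_eq_card hli, Fintype.card_fin]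

/-- The pivot coordinates determine the coefficient vector, so both expressions of `x` use the same
one; it is killed by `M - N`, whose rows are independent. -/
theorem eq_zero_of_mem_lift_of_mem_lift {a : ℕ} {M N : Matrix (Fin k) (Fin (n - (a + k))) F}
    (h : a + k ≤ n) (hMN : k ≤ (M - N).rank) {x : Fin n → F} (hM : x ∈ lift a M)
    (hN : x ∈ lift a N) : x = 0 := by
  obtain ⟨c, rfl⟩ := mem_lift.1 hM
  obtain ⟨d, hd⟩ := mem_lift.1 hN
  have hdc : d = c := by
    funext r
    have := congrFun hd ⟨a + r, by omega⟩
    simpa only [vecMul_liftMatrix_pivot] using this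
  subst hdc
  have h0 : Matrix.vecMul d (M - N) = Matrix.vecMul 0 (M - N) := by
    funext j
    have := congrFun hd ⟨a + k + j, by omega⟩
    simp only [vecMul_liftMatrix_free] at this
    simp [Matrix.vecMul_sub, this]
  have hli : LinearIndependent F (M - N).row := by
    rw [linearIndependent_iff_card_eq_finrank_span, Fintype.card_fin]
    refine le_antisymm (hMN.trans_eq (Matrix.rank_eq_finrank_span_row _)) ?_
    exact (finrank_range_le_card _).trans_eq (Fintype.card_fin k)
  rw [Matrix.vecMul_injective_iff.2 hli h0, Matrix.zero_vecMul]

/-- The pivots of the first block lie in the zero columns of the second. -/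
theorem eq_zero_of_mem_lift_of_add_le {a b : ℕ} {M : Matrix (Fin k) (Fin (n - (a + k))) F}
    {N : Matrix (Fin k) (Fin (n - (b + k))) F} (hab : a + k ≤ b) (h : a + k ≤ n)
    {x : Fin n → F} (hM : x ∈ lift a M) (hN : x ∈ lift b N) : x = 0 := by
  obtain ⟨c, rfl⟩ := mem_lift.1 hM
  obtain ⟨d, hd⟩ := mem_lift.1 hN
  have hc : c = 0 := by
    funext r
    have := congrFun hd ⟨a + r, by omega⟩
    rw [vecMul_liftMatrix_pivot, vecMul_liftMatrix_of_lt _ _ _ (by simp; omega)] at this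
    exact this.symm
  rw [hc, Matrix.zero_vecMul]

theorem block_le {i : ℕ} (hi : i < n / k) : i * k + k ≤ n :=
  calc i * k + k = (i + 1) * k := by ring
    _ ≤ n / k * k := Nat.mul_le_mul_right k hi
    _ ≤ n := Nat.div_mul_le_self n k

/-- The components of a multi-component code, and their members, meet trivially. -/
theorem eq_zero_of_mem_lift_of_sigma_ne
    {R : (i : Fin (n / k)) → Finset (Matrix (Fin k) (Fin (n - ((i : ℕ) * k + k))) F)}
    (hR : ∀ i, IsMRD k (R i)) {s t : Σ i : Fin (n / k),
      Matrix (Fin k) (Fin (n - ((i : ℕ) * k + k))) F} (hs : s.2 ∈ R s.1) (ht : t.2 ∈ R t.1)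
    (hst : s ≠ t) {x : Fin n → F} (hxs : x ∈ lift ((s.1 : ℕ) * k) s.2)
    (hxt : x ∈ lift ((t.1 : ℕ) * k) t.2) : x = 0 := by
  obtain ⟨i, M⟩ := s
  obtain ⟨j, N⟩ := t
  dsimp only at *
  have hlt {i j : ℕ} (h : i < j) : i * k + k ≤ j * k := by
    have := Nat.mul_le_mul_right k (Nat.succ_le_of_lt h)
    rwa [Nat.succ_mul] at this
  rcases lt_trichotomy i j with h | rfl | h
  · exact eq_zero_of_mem_lift_of_add_le (hlt h) (block_le i.2) hxs hxt
  · have hMN : M ≠ N := fun h => hst (by rw [h])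
    exact eq_zero_of_mem_lift_of_mem_lift (block_le i.2) ((hR i).1 M hs N ht hMN) hxs hxt
  · exact eq_zero_of_mem_lift_of_add_le (hlt h) (block_le j.2) hxt hxs

theorem IsMultiComponent.isPartialSpread {C : Finset (Submodule F (Fin n → F))}
    (hC : IsMultiComponent k C) : IsPartialSpread k C := by
  obtain ⟨R, hR, hC⟩ := hC
  have hmem {U : Submodule F (Fin n → F)} (hU : U ∈ C) :
      ∃ s : Σ i : Fin (n / k), Matrix (Fin k) (Fin (n - ((i : ℕ) * k + k))) F,
        s.2 ∈ R s.1 ∧ lift ((s.1 : ℕ) * k) s.2 = U := by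
    rw [← mem_coe, hC] at hU
    obtain ⟨i, M, hM, rfl⟩ := Set.mem_iUnion.1 hU
    exact ⟨⟨i, M⟩, hM, rfl⟩
  constructor
  · intro U hU
    obtain ⟨s, -, rfl⟩ := hmem hU
    exact finrank_lift _ (block_le s.1.2)
  · intro p hp U hU V hV hpU hpV
    obtain ⟨s, hs, rfl⟩ := hmem hU
    obtain ⟨t, ht, rfl⟩ := hmem hV
    by_contra hne
    have hst : s ≠ t := fun h => hne (by rw [h])
    have hbot : p = ⊥ := (Submodule.eq_bot_iff p).2 fun x hx =>
      eq_zero_of_mem_lift_of_sigma_ne hR hs ht hst (hpU hx) (hpV hx)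
    subst hbot
    exact zero_ne_one ((finrank_bot F _).symm.trans hp)

theorem IsMultiComponent.card_eq {C : Finset (Submodule F (Fin n → F))}
    (hC : IsMultiComponent k C) (hk : 0 < k) :
    #C = ∑ i : Fin (n / k), Nat.card F ^ (max k (n - ((i : ℕ) * k + k)) *
      (min k (n - ((i : ℕ) * k + k)) + 1 - k)) := by
  classical
  obtain ⟨R, hR, hC⟩ := hC
  have himg : C = (univ.sigma R).image fun s => lift ((s.1 : ℕ) * k) s.2 := by
    ext U
    rw [← mem_coe, hC]
    simp [Set.mem_iUnion]
  rw [himg, card_image_of_injOn, card_sigma]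
  · exact sum_congr rfl fun i _ => (hR i).2
  · intro s hs t ht hst
    simp only [coe_sigma, Set.mem_sigma_iff, mem_coe] at hs ht
    dsimp only at hst
    -- Distinct indices with equal lifts would force the lift to be `⊥`, against its dimension `k >
    -- 0`.
    by_contra hne
    have hbot : lift ((s.1 : ℕ) * k) s.2 = ⊥ := (Submodule.eq_bot_iff _).2 fun x hx =>
      eq_zero_of_mem_lift_of_sigma_ne hR hs.2 ht.2 hne hx (hst ▸ hx)
    have := finrank_lift s.2 (block_le s.1.2)
    rw [hbot, finrank_bot] at this
    omega

/-- The multiplication maps of an extension field of degree `w`, restricted to a fixed subspace of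
dimension `k`, form an MRD code. -/
theorem exists_isMRD_zmod_two {w : ℕ} (hk : 0 < k) :
    ∃ C : Finset (Matrix (Fin k) (Fin w) (ZMod 2)), IsMRD k C := by
  classical
  rcases lt_or_ge w k with hw | hw
  · refine ⟨{0}, by simp, ?_⟩
    rw [card_singleton, min_eq_right hw.le, show w + 1 - k = 0 by omega, mul_zero, pow_zero]
  let K := GaloisField 2 w
  have hfin : finrank (ZMod 2) K = w := GaloisField.finrank 2 (by omega)
  let b : Basis (Fin w) (ZMod 2) K := finBasisOfFinrankEq (ZMod 2) K hfin
  have := Fintype.ofFinite K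
  let f : K → Matrix (Fin k) (Fin w) (ZMod 2) := fun x =>
    Matrix.of fun r => b.equivFun (x * b (Fin.castLE hw r))
  have hrank {x y : K} (h : x ≠ y) : (f x - f y).rank = k := by
    have hsub : f x - f y = f (x - y) := by
      ext r j
      simp [f, sub_mul]
    have hli : LinearIndependent (ZMod 2) (f (x - y)).row := by
      have h1 : LinearIndependent (ZMod 2) fun r : Fin k => b (Fin.castLE hw r) :=
        b.linearIndependent.comp _ (Fin.castLE_injective hw)
      have h2 := h1.map' (LinearMap.mulLeft (ZMod 2) (x - y))
        (LinearMap.ker_eq_bot.2 (mul_right_injective₀ (sub_ne_zero.2 h)))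
      exact h2.map' b.equivFun.toLinearMap b.equivFun.ker
    rw [hsub, hli.rank_matrix, Fintype.card_fin]
  have hinj : Function.Injective f := by
    intro x y hxy
    by_contra h
    have := hrank h
    rw [hxy, sub_self, Matrix.rank_zero] at this
    omega
  refine ⟨univ.image f, ?_, ?_⟩
  · intro A hA B hB hAB
    obtain ⟨x, -, rfl⟩ := mem_image.1 hA
    obtain ⟨y, -, rfl⟩ := mem_image.1 hB
    exact (hrank fun h => hAB (by rw [h])).ge
  · rw [card_image_of_injective _ hinj, card_univ, ← Nat.card_eq_fintype_card,
      GaloisField.card 2 w (by omega), Nat.card_zmod, max_eq_right hw, min_eq_left hw,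
      Nat.add_sub_cancel_left, mul_one]

theorem exists_isMultiComponent_zmod_two (hk : 0 < k) (n : ℕ) :
    ∃ C : Finset (Submodule (ZMod 2) (Fin n → ZMod 2)), IsMultiComponent k C := by
  classical
  choose R hR using fun i : Fin (n / k) =>
    exists_isMRD_zmod_two (k := k) (w := n - ((i : ℕ) * k + k)) hk
  refine ⟨univ.biUnion fun i => (R i).image fun M => lift ((i : ℕ) * k) M, R, hR, ?_⟩
  simp

theorem IsMultiComponent.card_mul_add {t k : ℕ} (hk : 2 < k)
    {C : Finset (Submodule (ZMod 2) (Fin (k * (t + 1) + 2) → ZMod 2))}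
    (hC : IsMultiComponent k C) :
    #C * (2 ^ k - 1) + 3 * 2 ^ k + 1 = 2 ^ (k * (t + 1) + 2) := by
  have hdiv : (k * (t + 1) + 2) / k = t + 1 := by
    rw [Nat.mul_add_div (by omega), Nat.div_eq_of_lt hk, add_zero]
  rw [hC.card_eq (by omega), Nat.card_zmod,
    Fin.sum_univ_eq_sum_range (fun i => 2 ^ (max k (k * (t + 1) + 2 - (i * k + k)) *
      (min k (k * (t + 1) + 2 - (i * k + k)) + 1 - k))), hdiv, ← sum_range_reflect]
  -- In reflected order, index `0` is the last block, of width `2 < k`, contributing a single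
  -- matrix; index `j + 1` has width `k + 2 + k * j`.
  have hterm : ∀ j ∈ range t, 2 ^ (max k (k * (t + 1) + 2 - ((t + 1 - 1 - (j + 1)) * k + k)) *
      (min k (k * (t + 1) + 2 - ((t + 1 - 1 - (j + 1)) * k + k)) + 1 - k)) =
      2 ^ (k + 2) * (2 ^ k) ^ j := by
    intro j hj
    have hj' : j < t := mem_range.1 hj
    obtain ⟨m, rfl⟩ : ∃ m, t = m + (j + 1) := ⟨t - (j + 1), by omega⟩
    have hw : k * (m + (j + 1) + 1) + 2 - ((m + (j + 1) + 1 - 1 - (j + 1)) * k + k) =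
        k + 2 + k * j := by
      rw [Nat.add_sub_cancel, Nat.add_sub_cancel]
      refine Nat.sub_eq_of_eq_add ?_
      ring
    rw [hw, max_eq_right (by omega), min_eq_left (by omega), Nat.add_sub_cancel_left, mul_one,
      pow_add, pow_mul]
  rw [sum_range_succ', sum_congr rfl hterm, ← mul_sum]
  have hlast : k * (t + 1) + 2 - ((t + 1 - 1 - 0) * k + k) = 2 := by
    rw [Nat.add_sub_cancel, Nat.sub_zero]
    refine Nat.sub_eq_of_eq_add ?_
    ring
  rw [hlast, min_eq_right hk.le, show 2 + 1 - k = 0 by omega, mul_zero, pow_zero]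
  have hgeom : (∑ i ∈ range t, (2 ^ k) ^ i) * (2 ^ k - 1) + 1 = (2 ^ k) ^ t := by
    rw [geom_sum_mul_of_one_le Nat.one_le_two_pow, Nat.sub_add_cancel]
    exact Nat.one_le_pow _ _ (by positivity)
  have hpow : 2 ^ (k * (t + 1) + 2) = 2 ^ (k + 2) * (2 ^ k) ^ t := by
    rw [← pow_mul, ← pow_add]
    ring
  have h1 := Nat.one_le_two_pow (n := k)
  rw [hpow, ← hgeom]
  obtain ⟨q, hq⟩ : ∃ q, 2 ^ k = q + 1 := ⟨2 ^ k - 1, by omega⟩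
  rw [pow_add, hq, Nat.add_sub_cancel]
  ring

end MultiComponent

end SubspaceCode

/-! ### The exact value. -/

theorem mainTheorem1 (t k : ℕ) (ht : 1 ≤ t) (hk : 4 ≤ k) :
    -- the exact value of `A_2(k(t+1)+2, 2k; k)`
    (SubspaceCode.maxCodeSize (ZMod 2) (k * (t + 1) + 2) (2 * k) {k} : ℚ) =
        (2 ^ (k * (t + 1) + 2) - 3 * 2 ^ k - 1) / (2 ^ k - 1) ∧
    -- it is the maximum size of a partial `k`-spread
    IsGreatest {m : ℕ | ∃ P : Finset (Submodule (ZMod 2) (Fin (k * (t + 1) + 2) → ZMod 2)),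
        SubspaceCode.IsPartialSpread k P ∧ P.card = m}
      (SubspaceCode.maxCodeSize (ZMod 2) (k * (t + 1) + 2) (2 * k) {k}) ∧
    -- the multi-component construction can be carried out, and it is always optimal
    (∃ C : Finset (Submodule (ZMod 2) (Fin (k * (t + 1) + 2) → ZMod 2)),
      SubspaceCode.IsMultiComponent k C) ∧
    ∀ C : Finset (Submodule (ZMod 2) (Fin (k * (t + 1) + 2) → ZMod 2)),
      SubspaceCode.IsMultiComponent k C →
        SubspaceCode.IsPartialSpread k C ∧
          C.card = SubspaceCode.maxCodeSize (ZMod 2) (k * (t + 1) + 2) (2 * k) {k} := by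
  classical
  have hone : 1 < 2 ^ k := Nat.one_lt_two_pow (by omega)
  obtain ⟨C₀, hC₀⟩ :=
    SubspaceCode.exists_isMultiComponent_zmod_two (k := k) (by omega) (k * (t + 1) + 2)
  have hset : {m : ℕ | ∃ P : Finset (Submodule (ZMod 2) (Fin (k * (t + 1) + 2) → ZMod 2)),
      SubspaceCode.IsPartialSpread k P ∧ P.card = m} =
      {m : ℕ | ∃ P : Finset (Submodule (ZMod 2) (Fin (k * (t + 1) + 2) → ZMod 2)),
        SubspaceCode.IsCode (2 * k) {k} P ∧ P.card = m} := by
    simp only [SubspaceCode.isCode_iff_isPartialSpread]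
  have hgreatest := SubspaceCode.isGreatest_maxCodeSize (ZMod 2) (k * (t + 1) + 2) (2 * k) {k}
  rw [← hset] at hgreatest
  have hcard (C : Finset (Submodule (ZMod 2) (Fin (k * (t + 1) + 2) → ZMod 2)))
      (hC : SubspaceCode.IsMultiComponent k C) :
      C.card = SubspaceCode.maxCodeSize (ZMod 2) (k * (t + 1) + 2) (2 * k) {k} := by
    refine le_antisymm (hgreatest.2 ⟨C, hC.isPartialSpread, rfl⟩) ?_
    obtain ⟨P, hP, hPcard⟩ := hgreatest.1
    rw [← hPcard]
    -- The size of the given multi-component code itself serves as the bound `m`.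
    exact hP.card_le hk (by nlinarith) (hC.card_mul_add (by omega))
  refine ⟨?_, hgreatest, ⟨C₀, hC₀⟩, fun C hC => ⟨hC.isPartialSpread, hcard C hC⟩⟩
  have hmul := hC₀.card_mul_add (by omega)
  rw [hcard C₀ hC₀] at hmul
  have hq : (1 : ℚ) < 2 ^ k := by exact_mod_cast hone
  rw [eq_div_iff (by linarith)]
  have hmul' := congrArg (Nat.cast : ℕ → ℚ) hmul
  push_cast [Nat.cast_sub hone.le] at hmul'
  linarith
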